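/- For a metric space $\mathrm{M}=(M,d)$ let $\operatorname{dist}(\mathrm{M})=\{d(x,y) : x,y\in M\}$. A metric space $\mathrm{M}$ is \emph{homogeneous} if every isometry of a finite subspace of $\mathrm{M}$ to a subspace of $\mathrm{M}$ extends to an isometry of $\mathrm{M}$ onto $\mathrm{M}$. A \emph{Urysohn metric space} with set of distances $\mathcal{D}\subseteq\mathbb{R}_{\ge 0}$ is a homogeneous metric space $\mathrm{U}$ with $\operatorname{dist}(\mathrm{U})=\mathcal{D}$ such that every finite metric space $\mathrm{F}$ with $\operatorname{dist}(\mathrm{F})\subseteq\mathcal{D}$ embeds isometrically into $\mathrm{U}$. The set $\mathcal{D}$ is \emph{universal} if there exists a Urysohn metric space with set of distances $\mathcal{D}$. A \emph{copy} of $\mathrm{M}$ in $\mathrm{M}$ is the image of an isometric (not necessarily surjective) map $M\to M$, and $\mathrm{M}$ is \emph{indivisible} if for every colouring $\chi: M\to\{0,1\}$ there exist $i\in\{0,1\}$ and a copy $N$ of $\mathrm{M}$ in $\mathrm{M}$ such that $\chi(x)=i$ for all $x\in N$. \textbf{Theorem.} Let $\mathcal{D}\subseteq\mathbb{R}_{\ge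 0}$ be a finite universal set of numbers and let $\mathrm{M}$ be a countable Urysohn metric space with set of distances $\mathcal{D}$. Then $\mathrm{M}$ is indivisible. -/

import Mathlib

namespace UrysohnFinite

/-- The set of distances between points of a metric space (it contains `0` as soon as the space is
nonempty). -/
def distSet (M : Type*) [MetricSpace M] : Set ℝ :=
  {r | ∃ x y : M, dist x y = r}

/-- Every isometry of a finite subspace of `M` to a subspace of `M` extends to an isometry of `M`
onto `M`. -/
def IsHomogeneous (M : Type*) [MetricSpace M] : Prop :=
  ∀ (A : Set M), A.Finite → ∀ α : A → M, Isometry α →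
    ∃ g : M ≃ᵢ M, ∀ a : A, g (a : M) = α a

/-- `M` is a Urysohn metric space with set of distances `D`: it is homogeneous, its set of distances
is exactly `D`, and every finite metric space with distances in `D` embeds isometrically into `M`.
(Every finite metric space is isometric to one living in `Type`.) -/
structure IsUrysohn (D : Set ℝ) (M : Type*) [MetricSpace M] : Prop where
  distSet_eq : distSet M = D
  homogeneous : IsHomogeneous M
  embeds_finite : ∀ (F : Type) [MetricSpace F] [Finite F], distSet F ⊆ D →
    ∃ f : F → M, Isometry f

/-- A set of numbers is universal if it is the set of distances of some Urysohn metric space. -/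
def IsUniversal (D : Set ℝ) : Prop :=
  ∃ (U : Type) (_ : MetricSpace U), IsUrysohn D U

/-- A copy of `M` in `M` is the image of an isometry of `M` into `M`. -/
def IsCopy {M : Type*} [MetricSpace M] (N : Set M) : Prop :=
  ∃ f : M → M, Isometry f ∧ Set.range f = N

/-- For every colouring of the points with two colours there is a monochromatic copy of `M`
in `M`. -/
def IsIndivisible (M : Type*) [MetricSpace M] : Prop :=
  ∀ χ : M → Fin 2, ∃ (i : Fin 2) (N : Set M), IsCopy N ∧ ∀ x ∈ N, χ x = i

end UrysohnFinite

/-! Truncated addition `a ⊕ b = max {c ∈ D | c ≤ a + b}` makes `D` an ordered commutative monoid: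
associativity is exactly amalgamation of two triangles along a side (`IsUrysohn.exists_amalgam`).
The metric axioms over `D` can then be stated inside this monoid.

Finite words over `D` carry a `D`-valued metric, `wordDist` (`wordDist_triangle`). The word space is
countable, so it maps isometrically into `M` (`IsUrysohn.exists_map_of_countable`), and a colouring
of `M` becomes a colouring of words. An ultrafilter argument in the style of Gowers' theorem
(`exists_monochromatic_raisedProd`) yields words `w 0, w 1, ...`, each containing the letter `0`,
such that all concatenations of raised `w k` with at least one factor left unraised have one colour.

Enumerate `M` as `pt` and code a point `x` of index `n` by `w 0, ..., w n`, with `w k` raised to `d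
x (pt k)`; the last factor is raised to `0`, so the code has the right colour. For `y` of larger
index, the triangle inequality makes every pair of aligned letters compatible with `d x y`, and the
letter `0` of `w n` produces the pair `(0, d y x)`, which forces the word distance to be `d x y`
(`wordDist_eq`). The codes thus form a monochromatic copy of `M`. -/

namespace UrysohnFinite

/-! ### A metric on words over an ordered monoid with subtraction. -/

section WordMetric

variable {A : Type*} [LinearOrder A] [AddCommMonoid A] [Sub A]

/-- The symmetric residual of two elements: the least `c` with `a ≤ c + b` and `b ≤ c + a`. -/
def gap (a b : A) : A := max (a - b) (b - a)

/-- A state is an interval `[s.1, s.2]` of admissible distances. Reading the letters `a` and `b`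
narrows it towards `[gap a b, a + b]`, without ever leaving the old interval. -/
def narrow (s : A × A) (p : A × A) : A × A :=
  (max s.1 (min s.2 (gap p.1 p.2)), max s.1 (min s.2 (p.1 + p.2)))

/-- The interval of admissible distances after reading two words up to the shorter length. -/
def narrowList (s : A × A) (u v : List A) : A × A := (u.zip v).foldl narrow s

lemma gap_comm {A : Type*} [LinearOrder A] [Sub A] (a b : A) : gap a b = gap b a := max_comm _ _

lemma narrow_swap (s : A × A) (a b : A) : narrow s (a, b) = narrow s (b, a) := by
  simp [narrow, gap_comm a b, add_comm a b]

lemma narrowList_comm (s : A × A) (u v : List A) : narrowList s u v = narrowList s v u := by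
  induction u generalizing s v with
  | nil => cases v <;> simp [narrowList]
  | cons a u ih =>
    cases v with
    | nil => simp [narrowList]
    | cons b v =>
      have := ih (narrow s (a, b)) v
      simp only [narrowList, List.zip_cons_cons, List.foldl_cons] at this ⊢
      rw [this, narrow_swap]

open Classical in
/-- The distance of two words. -/
noncomputable def wordDist [OrderTop A] (u v : List A) : A :=
  if u = v then 0 else (narrowList (0, ⊤) u v).2

lemma wordDist_self [OrderTop A] (u : List A) : wordDist u u = 0 := if_pos rfl

lemma wordDist_comm [OrderTop A] (u v : List A) : wordDist u v = wordDist v u := by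
  simp only [wordDist, eq_comm (a := u), narrowList_comm _ u v]

/-- Coherence of the states `r`, `s`, `t` of the three sides of a triangle, in one of the possible
orientations. -/
def Coherent (r s t : A × A) : Prop := t.2 ≤ r.2 + s.1 ∧ t.2 ≤ r.1 + s.2 ∧ t.1 ≤ r.1 + s.1

lemma gap_le_iff [OrderedSub A] {a b c : A} : gap a b ≤ c ↔ a ≤ c + b ∧ b ≤ c + a := by
  simp [gap, tsub_le_iff_right]

lemma le_gap_add [OrderedSub A] (a b : A) : a ≤ gap a b + b := (gap_le_iff.1 le_rfl).1

variable [IsOrderedAddMonoid A] [OrderedSub A]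

lemma gap_triangle (a b c : A) : gap a c ≤ gap a b + gap b c := by
  rw [gap_le_iff]
  constructor
  · calc a ≤ gap a b + b := le_gap_add a b
      _ ≤ gap a b + (gap b c + c) := by gcongr; exact le_gap_add b c
      _ = _ := by rw [add_assoc]
  · calc c ≤ gap c b + b := le_gap_add c b
      _ ≤ gap c b + (gap b a + a) := by gcongr; exact le_gap_add b a
      _ = _ := by rw [gap_comm c b, gap_comm b a, ← add_assoc, add_comm (gap b c)]

lemma gap_le_add (h0 : ∀ a : A, 0 ≤ a) (a b : A) : gap a b ≤ a + b := by
  rw [gap_le_iff]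
  constructor
  · rw [add_assoc]; exact le_add_of_nonneg_right (h0 _)
  · rw [add_comm a b, add_assoc]; exact le_add_of_nonneg_right (h0 _)

lemma narrow_mem (h0 : ∀ a : A, 0 ≤ a) {s : A × A} (hs : s.1 ≤ s.2) (p : A × A) :
    s.1 ≤ (narrow s p).1 ∧ (narrow s p).1 ≤ (narrow s p).2 ∧ (narrow s p).2 ≤ s.2 := by
  refine ⟨le_max_left _ _, ?_, ?_⟩
  · exact max_le_max le_rfl (min_le_min le_rfl (gap_le_add h0 _ _))
  · exact max_le hs (min_le_left _ _)

lemma foldl_narrow_mem (h0 : ∀ a : A, 0 ≤ a) {s : A × A} (hs : s.1 ≤ s.2) (l : List (A × A)) :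
    s.1 ≤ (l.foldl narrow s).1 ∧ (l.foldl narrow s).1 ≤ (l.foldl narrow s).2 ∧
      (l.foldl narrow s).2 ≤ s.2 := by
  induction l generalizing s with
  | nil => exact ⟨le_rfl, hs, le_rfl⟩
  | cons p l ih =>
    obtain ⟨h1, h2, h3⟩ := narrow_mem h0 hs p
    obtain ⟨k1, k2, k3⟩ := ih h2
    exact ⟨h1.trans k1, k2, k3.trans h3⟩

/-- If all pairs of letters are compatible with the distance `d` then so is the final interval, and
a pair of letters with sum `d` pins the upper end of the interval to `d`. -/
lemma foldl_narrow_snd_eq (h0 : ∀ a : A, 0 ≤ a) {s : A × A} {d : A} (hs1 : s.1 ≤ d)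
    (hs2 : d ≤ s.2) (l : List (A × A))
    (hl : ∀ p ∈ l, gap p.1 p.2 ≤ d ∧ d ≤ p.1 + p.2) (hd : ∃ p ∈ l, p.1 + p.2 = d) :
    (l.foldl narrow s).2 = d := by
  have key : ∀ (l : List (A × A)) (s : A × A), s.1 ≤ d → d ≤ s.2 →
      (∀ p ∈ l, gap p.1 p.2 ≤ d ∧ d ≤ p.1 + p.2) →
      d ≤ (l.foldl narrow s).2 ∧ ((∃ p ∈ l, p.1 + p.2 = d) → (l.foldl narrow s).2 ≤ d) := by
    intro l
    induction l with
    | nil => intro s _ h2 _; exact ⟨h2, by simp⟩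
    | cons p l ih =>
      intro s h1 h2 h3
      obtain ⟨hp1, hp2⟩ := h3 p (by simp)
      have e1 : (narrow s p).1 ≤ d := max_le h1 ((min_le_right _ _).trans hp1)
      have e2 : d ≤ (narrow s p).2 := le_max_of_le_right (le_min h2 hp2)
      obtain ⟨k1, k2⟩ := ih (narrow s p) e1 e2 (fun q hq => h3 q (by simp [hq]))
      refine ⟨k1, ?_⟩
      rintro ⟨q, hq, hqd⟩
      rcases List.mem_cons.1 hq with rfl | hq
      · have : (narrow s q).2 ≤ d := max_le h1 ((min_le_right _ _).trans hqd.le)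
        exact (foldl_narrow_mem h0 (e1.trans e2) l).2.2.trans this
      · exact k2 ⟨q, hq, hqd⟩
  exact le_antisymm ((key l s hs1 hs2 hl).2 hd) (key l s hs1 hs2 hl).1

/-- If a gap on the right overshoots its interval, that lower end jumps to the old upper end and
coherence suffices; otherwise both gaps are attained and `gap_triangle` applies. -/
lemma narrow_lower_triangle (h0 : ∀ a : A, 0 ≤ a) {r s t : A × A} (hr : r.1 ≤ r.2)
    (hs : s.1 ≤ s.2) (ht : t.1 ≤ t.2)
    (H : Coherent r s t) (a b c : A) :
    (narrow t (a, c)).1 ≤ (narrow r (a, b)).1 + (narrow s (b, c)).1 := by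
  have mr := narrow_mem h0 hr (a, b)
  have ms := narrow_mem h0 hs (b, c)
  have mt := narrow_mem h0 ht (a, c)
  obtain ⟨H1, H2, H3⟩ := H
  have htop : (narrow t (a, c)).1 ≤ t.2 := mt.2.1.trans mt.2.2
  rcases le_total r.2 (gap a b) with h | h
  · have : r.2 ≤ (narrow r (a, b)).1 := by simp [narrow, h]
    exact htop.trans (H1.trans (add_le_add this ms.1))
  rcases le_total s.2 (gap b c) with h' | h'
  · have : s.2 ≤ (narrow s (b, c)).1 := by simp [narrow, h']
    exact htop.trans (H2.trans (add_le_add mr.1 this))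
  refine max_le (H3.trans (add_le_add mr.1 ms.1)) ((min_le_right _ _).trans ?_)
  refine (gap_triangle a b c).trans (add_le_add ?_ ?_)
  · simp [narrow, h]
  · simp [narrow, h']

lemma narrow_upper_triangle (h0 : ∀ a : A, 0 ≤ a) {r s t : A × A} (hr : r.1 ≤ r.2)
    (hs : s.1 ≤ s.2) (ht : t.1 ≤ t.2)
    (H : Coherent r s t) (a b c : A) :
    (narrow t (a, c)).2 ≤ (narrow r (a, b)).2 + (narrow s (b, c)).2 := by
  have mr := narrow_mem h0 hr (a, b)
  have ms := narrow_mem h0 hs (b, c)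
  have mt := narrow_mem h0 ht (a, c)
  obtain ⟨H1, H2, H3⟩ := H
  rcases le_total r.2 (a + b) with h | h
  · have : r.2 ≤ (narrow r (a, b)).2 := by simp [narrow, h]
    exact mt.2.2.trans (H1.trans (add_le_add this (ms.1.trans ms.2.1)))
  rcases le_total s.2 (b + c) with h' | h'
  · have : s.2 ≤ (narrow s (b, c)).2 := by simp [narrow, h']
    exact mt.2.2.trans (H2.trans (add_le_add (mr.1.trans mr.2.1) this))
  refine max_le (H3.trans (add_le_add (mr.1.trans mr.2.1) (ms.1.trans ms.2.1)))
    ((min_le_right _ _).trans ?_)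
  have e1 : a ≤ (narrow r (a, b)).2 :=
    (le_add_of_nonneg_right (h0 b)).trans (by simp [narrow, h])
  have e2 : c ≤ (narrow s (b, c)).2 :=
    (le_add_of_nonneg_left (h0 b)).trans (by simp [narrow, h'])
  exact add_le_add e1 e2

/-- When no clamping interferes, this is `a + c ≤ (a + b) + gap b c`. If `gap b c` overshoots, the
interval of `s` collapses to a point and the upper triangle inequality is enough. -/
lemma narrow_mixed_triangle (h0 : ∀ a : A, 0 ≤ a) {r s t : A × A} (hr : r.1 ≤ r.2)
    (hs : s.1 ≤ s.2) (ht : t.1 ≤ t.2)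
    (H : Coherent r s t) (a b c : A) :
    (narrow t (a, c)).2 ≤ (narrow r (a, b)).2 + (narrow s (b, c)).1 := by
  have mr := narrow_mem h0 hr (a, b)
  have ms := narrow_mem h0 hs (b, c)
  have mt := narrow_mem h0 ht (a, c)
  rcases le_total s.2 (gap b c) with h' | h'
  · have : (narrow s (b, c)).2 ≤ (narrow s (b, c)).1 := ms.2.2.trans (by simp [narrow, h'])
    exact (narrow_upper_triangle h0 hr hs ht H a b c).trans (add_le_add le_rfl this)
  obtain ⟨H1, H2, H3⟩ := H
  rcases le_total r.2 (a + b) with h | h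
  · have : r.2 ≤ (narrow r (a, b)).2 := by simp [narrow, h]
    exact mt.2.2.trans (H1.trans (add_le_add this ms.1))
  refine max_le (H3.trans (add_le_add (mr.1.trans mr.2.1) ms.1)) ((min_le_right _ _).trans ?_)
  have e1 : a + b ≤ (narrow r (a, b)).2 := by simp [narrow, h]
  have e2 : gap b c ≤ (narrow s (b, c)).1 := by simp [narrow, h']
  calc a + c ≤ a + (gap c b + b) := by gcongr; exact le_gap_add c b
    _ = (a + b) + gap b c := by rw [gap_comm c b, add_comm (gap b c), ← add_assoc]
    _ ≤ _ := add_le_add e1 e2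

lemma Coherent.narrow (h0 : ∀ a : A, 0 ≤ a) {r s t : A × A} (hr : r.1 ≤ r.2) (hs : s.1 ≤ s.2)
    (ht : t.1 ≤ t.2)
    (H : Coherent r s t) (a b c : A) :
    Coherent (narrow r (a, b)) (narrow s (b, c)) (narrow t (a, c)) := by
  refine ⟨narrow_mixed_triangle h0 hr hs ht H a b c, ?_, narrow_lower_triangle h0 hr hs ht H a b c⟩
  have H' : Coherent s r t := by
    obtain ⟨H1, H2, H3⟩ := H
    exact ⟨by rwa [add_comm], by rwa [add_comm], by rwa [add_comm]⟩
  have := narrow_mixed_triangle h0 hs hr ht H' c b a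
  rwa [narrow_swap t, narrow_swap r, narrow_swap s, add_comm]

/-- Once one word ends, the two sides at it freeze while the third keeps narrowing inside its
interval. The mixed inequalities in `Coherent` survive this, since they bound an upper end by a sum
involving a lower end, and lower ends only grow. -/
lemma narrowList_triangle (h0 : ∀ a : A, 0 ≤ a) (u v w : List A) {r s t : A × A} (hr : r.1 ≤ r.2)
    (hs : s.1 ≤ s.2)
    (ht : t.1 ≤ t.2) (H1 : Coherent r s t) (H2 : Coherent t s r) (H3 : Coherent r t s) :
    (narrowList t u w).2 ≤ (narrowList r u v).2 + (narrowList s v w).2 := by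
  induction u generalizing v w r s t with
  | nil =>
    have ms := foldl_narrow_mem h0 hs (v.zip w)
    simp only [narrowList, List.zip_nil_left, List.foldl_nil]
    exact H1.1.trans (add_le_add le_rfl (ms.1.trans ms.2.1))
  | cons a u ih =>
    rcases v with _ | ⟨b, v⟩
    · have mt := foldl_narrow_mem h0 ht ((a :: u).zip w)
      simp only [narrowList, List.zip_nil_left, List.zip_nil_right, List.foldl_nil]
      exact mt.2.2.trans (H1.1.trans (add_le_add le_rfl hs))
    rcases w with _ | ⟨c, w⟩
    · have mr := foldl_narrow_mem h0 hr ((a :: u).zip (b :: v))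
      simp only [narrowList, List.zip_nil_right, List.foldl_nil] at mr ⊢
      exact H1.2.1.trans (add_le_add (mr.1.trans mr.2.1) le_rfl)
    · simp only [narrowList, List.zip_cons_cons, List.foldl_cons]
      refine ih v w (narrow_mem h0 hr _).2.1 (narrow_mem h0 hs _).2.1 (narrow_mem h0 ht _).2.1
        (H1.narrow h0 hr hs ht a b c) ?_ ?_
      · have := H2.narrow h0 ht hs hr a c b
        rwa [narrow_swap s] at this
      · have := H3.narrow h0 hr ht hs b a c
        rwa [narrow_swap r] at this

variable [OrderTop A]

lemma wordDist_triangle (h0 : ∀ a : A, 0 ≤ a) (u v w : List A) :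
    wordDist u w ≤ wordDist u v + wordDist v w := by
  by_cases h1 : u = w
  · subst h1; rw [wordDist_self]; exact h0 _
  by_cases h2 : u = v
  · subst h2; rw [wordDist_self, zero_add]
  by_cases h3 : v = w
  · subst h3; rw [wordDist_self, add_zero]
  have H : Coherent ((0, ⊤) : A × A) (0, ⊤) (0, ⊤) := by simp [Coherent]
  simpa only [wordDist, if_neg h1, if_neg h2, if_neg h3] using
    narrowList_triangle h0 u v w (h0 _) (h0 _) (h0 _) H H H

lemma wordDist_eq (h0 : ∀ a : A, 0 ≤ a) {u v : List A} {d : A} (huv : u ≠ v)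
    (hl : ∀ p ∈ u.zip v, gap p.1 p.2 ≤ d ∧ d ≤ p.1 + p.2) (hd : ∃ p ∈ u.zip v, p.1 + p.2 = d) :
    wordDist u v = d := by
  rw [wordDist, if_neg huv]
  exact foldl_narrow_snd_eq h0 (h0 d) le_top _ hl hd

end WordMetric

/-! ### Ramsey theory of raised words via idempotent ultrafilters. -/

section UltrafilterProducts

open Filter

attribute [local instance] Ultrafilter.mul Ultrafilter.semigroup

lemma ultrafilter_map_mul {M N : Type*} [Monoid M] [Monoid N] (f : M →* N) (U V : Ultrafilter M) :
    (U * V).map f = U.map f * V.map f := by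
  refine Ultrafilter.coe_inj.1 (Filter.ext' fun p => ?_)
  rw [Ultrafilter.eventually_mul]
  simp only [Ultrafilter.coe_map, eventually_map]
  rw [Ultrafilter.eventually_mul]
  simp only [map_mul]

lemma ultrafilter_map_congr {M N : Type*} {f g : M → N} {U : Ultrafilter M}
    (h : ∀ᶠ x in U, f x = g x) : U.map f = U.map g :=
  Ultrafilter.coe_inj.1 (Filter.map_congr h)

variable {A : Type*} [LinearOrder A]

/-- Raise all letters of a word to at least `a`. -/
def raise (a : A) : FreeMonoid A →* FreeMonoid A := FreeMonoid.map (max a)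

/-- The words with least letter `a`. -/
def leastLetter (a : A) : Set (FreeMonoid A) :=
  {w | a ∈ w.toList ∧ ∀ x ∈ w.toList, a ≤ x}

lemma raise_raise (a b : A) (w : FreeMonoid A) : raise a (raise b w) = raise (max a b) w := by
  simp only [raise, FreeMonoid.map_map]
  congr 2
  ext x
  simp [max_assoc]

lemma raise_eq_self {a : A} {w : FreeMonoid A} (h : ∀ x ∈ w.toList, a ≤ x) : raise a w = w := by
  apply FreeMonoid.toList.injective
  simp only [raise, FreeMonoid.toList_map]
  conv_rhs => rw [← List.map_id w.toList]
  exact List.map_congr_left fun x hx => max_eq_right (h x hx)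

lemma leastLetter_mul {a : A} {v w : FreeMonoid A} (hv : v ∈ leastLetter a)
    (hw : w ∈ leastLetter a) : v * w ∈ leastLetter a := by
  simp only [leastLetter, Set.mem_ofPred_eq, FreeMonoid.toList_mul, List.mem_append] at *
  exact ⟨Or.inl hv.1, fun x hx => hx.elim (hv.2 x) (hw.2 x)⟩

lemma raise_map_raise_map (a b : A) (U : Ultrafilter (FreeMonoid A)) :
    (U.map (raise b)).map (raise a) = U.map (raise (max a b)) := by
  rw [Ultrafilter.map_map]
  congr 1
  ext1 w
  exact raise_raise a b w

lemma raise_map_eq_self {a : A} {U : Ultrafilter (FreeMonoid A)} (h : leastLetter a ∈ U) :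
    U.map (raise a) = U := by
  conv_rhs => rw [← U.map_id]
  exact ultrafilter_map_congr (Filter.mem_of_superset h fun w hw => raise_eq_self hw.2)

/-- There is an ultrafilter on the words with least letter `a` that absorbs all its raised
images. -/
lemma exists_absorbing_ultrafilter [Finite A] (a : A) :
    ∃ U : Ultrafilter (FreeMonoid A), leastLetter a ∈ U ∧
      ∀ b, a ≤ b → U.map (raise b) * U = U ∧ U * U.map (raise b) = U := by
  induction a using WellFoundedGT.induction with
  | ind a ih =>
  by_cases hmax : ∃ b, a < b
  · obtain ⟨a', ha', hmin⟩ : ∃ a', a < a' ∧ ∀ b, a < b → a' ≤ b := by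
      obtain ⟨a', h⟩ := WellFounded.has_min (wellFounded_lt (α := A)) {b | a < b} hmax
      exact ⟨a', h.1, fun b hb => not_lt.1 (h.2 b hb)⟩
    obtain ⟨U, hU, hUabs⟩ := ih a' ha'
    have hUr : U.map (raise a') = U := raise_map_eq_self hU
    have hUU : U * U = U := by simpa [hUr] using (hUabs a' le_rfl).1
    -- Downward induction on letters: `a'` is the successor of `a`, and `S` consists of the lifts of
    -- `U` to words with least letter `a`.
    let S : Set (Ultrafilter (FreeMonoid A)) := {V | leastLetter a ∈ V ∧ V.map (raise a') = U}
    have hSclosed : IsClosed S := by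
      have : S = {V | leastLetter a ∈ V} ∩ ⋂ B ∈ U, {V | raise a' ⁻¹' B ∈ V} := by
        ext V
        simp only [S, Set.mem_ofPred_eq, Set.mem_inter_iff, Set.mem_iInter]
        refine and_congr_right fun _ => ⟨?_, fun h => ?_⟩
        · rintro rfl B hB
          exact hB
        · exact Ultrafilter.eq_of_le (fun B hB => h B hB)
      rw [this]
      exact (ultrafilter_isClosed_basic _).inter
        (isClosed_biInter fun B _ => ultrafilter_isClosed_basic _)
    have hSne : S.Nonempty := by
      -- Lowering `a'` to `a` is a section of `raise a'` on words with least letter `a'`.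
      let σ : FreeMonoid A →* FreeMonoid A := FreeMonoid.map fun x => if x = a' then a else x
      refine ⟨U.map σ, ?_, ?_⟩
      · change ∀ᶠ w in U, σ w ∈ leastLetter a
        refine Filter.mem_of_superset hU fun w hw => ?_
        simp only [leastLetter, Set.mem_ofPred_eq, σ, FreeMonoid.toList_map,
          List.mem_map]
        refine ⟨⟨a', hw.1, by simp⟩, ?_⟩
        rintro _ ⟨x, hx, rfl⟩
        split_ifs
        · exact le_rfl
        · exact ha'.le.trans (hw.2 x hx)
      · rw [Ultrafilter.map_map]
        conv_rhs => rw [← U.map_id]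
        refine ultrafilter_map_congr (Filter.mem_of_superset hU fun w hw => ?_)
        apply FreeMonoid.toList.injective
        simp only [Function.comp, raise, σ, FreeMonoid.toList_map, List.map_map, id]
        conv_rhs => rw [← List.map_id w.toList]
        refine List.map_congr_left fun x hx => ?_
        have := hw.2 x hx
        by_cases hxa : x = a' <;> simp [hxa, ha'.le, this]
    have hSU : ∀ V ∈ S, V * U ∈ S := by
      rintro V ⟨hV1, hV2⟩
      refine ⟨?_, by rw [ultrafilter_map_mul, hV2, hUr, hUU]⟩
      change ∀ᶠ w in ↑(V * U), w ∈ leastLetter a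
      rw [Ultrafilter.eventually_mul]
      filter_upwards [hV1] with v hv
      filter_upwards [hU] with w hw
      simp only [leastLetter, Set.mem_ofPred_eq, FreeMonoid.toList_mul, List.mem_append] at *
      exact ⟨Or.inl hv.1, fun x hx => hx.elim (hv.2 x) fun h => ha'.le.trans (hw.2 x h)⟩
    have hSS : ∀ V ∈ S, ∀ W ∈ S, V * W ∈ S := by
      rintro V ⟨hV1, hV2⟩ W ⟨hW1, hW2⟩
      refine ⟨?_, by rw [ultrafilter_map_mul, hV2, hW2, hUU]⟩
      change ∀ᶠ w in ↑(V * W), w ∈ leastLetter a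
      rw [Ultrafilter.eventually_mul]
      filter_upwards [hV1] with v hv
      filter_upwards [hW1] with w hw using leastLetter_mul hv hw
    -- The idempotent is taken in `S * U`, so that it already ends in `U`; compactness holds because
    -- `· * U` is continuous.
    obtain ⟨V, ⟨X, hX, rfl⟩, hidem⟩ := exists_idempotent_in_compact_subsemigroup
      Ultrafilter.continuous_mul_left ((· * U) '' S) (hSne.image _)
      (hSclosed.isCompact.image (Ultrafilter.continuous_mul_left U)) (by
        rintro _ ⟨V, hV, rfl⟩ _ ⟨W, hW, rfl⟩
        exact ⟨V * U * W, hSS _ (hSU V hV) W hW, by simp only [mul_assoc]⟩)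
    simp only at hidem
    have hXU : X * U ∈ S := hSU X hX
    have hL : leastLetter a ∈ U * (X * U) := by
      change ∀ᶠ w in ↑(U * (X * U)), w ∈ leastLetter a
      rw [Ultrafilter.eventually_mul]
      filter_upwards [hU] with v hv
      filter_upwards [hXU.1] with w hw
      simp only [leastLetter, Set.mem_ofPred_eq, FreeMonoid.toList_mul, List.mem_append] at *
      exact ⟨Or.inr hw.1, fun x hx => hx.elim (fun h => ha'.le.trans (hv.2 x h)) (hw.2 x)⟩
    -- With `U` at both ends, the absorption properties of `U` apply on the left and on the right.
    refine ⟨U * (X * U), hL, fun b hb => ?_⟩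
    rcases hb.eq_or_lt with rfl | hb
    · have : U * (X * U) * (U * (X * U)) = U * (X * U) := by
        calc U * (X * U) * (U * (X * U)) = U * (X * (U * U) * (X * U)) := by simp only [mul_assoc]
          _ = _ := by rw [hUU, hidem]
      rw [raise_map_eq_self hL]
      exact ⟨this, this⟩
    · have hmap : (U * (X * U)).map (raise b) = U.map (raise b) := by
        have e : b = max b a' := (max_eq_left (hmin b hb)).symm
        conv_lhs => rw [e]
        rw [← raise_map_raise_map, ultrafilter_map_mul, hXU.2, hUr, hUU]
      rw [hmap]
      obtain ⟨h1, h2⟩ := hUabs b (hmin b hb)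
      exact ⟨by rw [← mul_assoc, h1], by rw [mul_assoc, mul_assoc, h2]⟩
  · have hmax' : ∀ b, b ≤ a := fun b => not_lt.1 fun h => hmax ⟨b, h⟩
    obtain ⟨U, hU, hidem⟩ := exists_idempotent_in_compact_subsemigroup
      Ultrafilter.continuous_mul_left {V : Ultrafilter (FreeMonoid A) | leastLetter a ∈ V}
      ⟨pure (FreeMonoid.of a), by simp [leastLetter]⟩
      (ultrafilter_isClosed_basic _).isCompact (by
        intro V hV W hW
        change ∀ᶠ w in ↑(V * W), w ∈ leastLetter a
        rw [Ultrafilter.eventually_mul]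
        filter_upwards [hV] with v hv
        filter_upwards [hW] with w hw using leastLetter_mul hv hw)
    refine ⟨U, hU, fun b hb => ?_⟩
    obtain rfl := le_antisymm hb (hmax' b)
    rw [raise_map_eq_self hU]
    exact ⟨hidem, hidem⟩

/-- The concatenation of the first `n` words of `w`, the `i`-th one raised to `u i`. -/
def raisedProd (w : ℕ → FreeMonoid A) (u : ℕ → A) : ℕ → FreeMonoid A
  | 0 => 1
  | n + 1 => raisedProd w u n * raise (u n) (w n)

/-- For every two-colouring of the words there is a sequence of words with least letter `o` all of
whose raised concatenations with at least one unraised word have the same colour. -/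
theorem exists_monochromatic_raisedProd [Finite A] {o : A} (ho : ∀ a, o ≤ a)
    (χ : FreeMonoid A → Fin 2) :
    ∃ (i : Fin 2) (w : ℕ → FreeMonoid A), (∀ n, o ∈ (w n).toList) ∧
      ∀ (u : ℕ → A) (n : ℕ), (∃ k < n, u k = o) → χ (raisedProd w u n) = i := by
  obtain ⟨U, hU, hUabs⟩ := exists_absorbing_ultrafilter o
  -- Apply `raise` by the smaller letter to the absorption identity for the larger one.
  have hmul : ∀ b c, U.map (raise b) * U.map (raise c) = U.map (raise (min b c)) := by
    intro b c
    rcases le_total b c with h | h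
    · have := congrArg (Ultrafilter.map (raise b)) (hUabs c (ho c)).2
      rw [min_eq_left h]
      rwa [ultrafilter_map_mul, raise_map_raise_map, max_eq_right h] at this
    · have := congrArg (Ultrafilter.map (raise c)) (hUabs b (ho b)).1
      rw [min_eq_right h]
      rwa [ultrafilter_map_mul, raise_map_raise_map, max_eq_right h] at this
  have hUo : U.map (raise o) = U := raise_map_eq_self hU
  obtain ⟨i, hi⟩ : ∃ i, ∀ᶠ w in U, χ w = i := by
    have := (U.map χ).eq_pure_of_finite
    obtain ⟨i, hi⟩ := this
    refine ⟨i, ?_⟩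
    have : {i} ∈ U.map χ := by rw [hi]; exact rfl
    exact this
  -- `Open` is the invariant of every prefix, even without an unraised factor; `Closed` is the
  -- stronger one, acquired with the first unraised factor and kept from then on.
  let Open : FreeMonoid A → Prop := fun p => ∀ᶠ y in U, χ (p * y) = i
  let Closed : FreeMonoid A → Prop := fun p =>
    χ p = i ∧ ∀ c, ∀ᶠ y in U.map (raise c), χ (p * y) = i
  have step : ∀ p c, (Open p → ∀ᶠ x in U, Open (p * raise c x)) ∧
      (Open p → c = o → ∀ᶠ x in U, Closed (p * raise c x)) ∧
      (Closed p → ∀ᶠ x in U, Closed (p * raise c x)) := by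
    intro p c
    refine ⟨fun h => ?_, fun h hc => ?_, fun h => ?_⟩
    · have h' : ∀ᶠ y in ↑(U.map (raise c) * U), χ (p * y) = i := by rwa [(hUabs c (ho c)).1]
      rw [Ultrafilter.eventually_mul] at h'
      simp only [← mul_assoc] at h'
      exact h'
    · subst hc
      have e : ∀ᶠ x in U, raise c x = x := Filter.mem_of_superset hU fun x hx => raise_eq_self hx.2
      have h1 : ∀ e, ∀ᶠ x in U, ∀ᶠ y in U.map (raise e), χ (p * x * y) = i := by
        intro e
        have h' : ∀ᶠ y in ↑(U * U.map (raise e)), χ (p * y) = i := by rwa [(hUabs e (ho e)).2]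
        rw [Ultrafilter.eventually_mul] at h'
        simpa only [← mul_assoc] using h'
      filter_upwards [e, h, Filter.eventually_all.2 h1] with x hx hx1 hx2
      rw [hx]
      exact ⟨hx1, hx2⟩
    · have h1 : ∀ e, ∀ᶠ x in U, ∀ᶠ y in U.map (raise e), χ (p * raise c x * y) = i := by
        intro e
        have h' : ∀ᶠ y in ↑(U.map (raise c) * U.map (raise e)), χ (p * y) = i := by
          rw [hmul]; exact h.2 _
        rw [Ultrafilter.eventually_mul] at h'
        simp only [← mul_assoc] at h'
        exact h'
      filter_upwards [h.2 c, Filter.eventually_all.2 h1] with x hx1 hx2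
      exact ⟨hx1, hx2⟩
  have next : ∀ P : Finset (FreeMonoid A), ∃ x : FreeMonoid A, o ∈ x.toList ∧ ∀ p ∈ P, ∀ c,
      (Open p → Open (p * raise c x)) ∧ (Open p → c = o → Closed (p * raise c x)) ∧
      (Closed p → Closed (p * raise c x)) := by
    intro P
    have : ∀ᶠ x in U, ∀ p ∈ P, ∀ c,
      (Open p → Open (p * raise c x)) ∧ (Open p → c = o → Closed (p * raise c x)) ∧
      (Closed p → Closed (p * raise c x)) := by
      rw [Filter.eventually_all_finset]
      intro p _
      rw [Filter.eventually_all]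
      intro c
      obtain ⟨h1, h2, h3⟩ := step p c
      exact (Filter.eventually_imp_distrib_left.2 h1).and
        ((Filter.eventually_imp_distrib_left.2 fun h =>
          Filter.eventually_imp_distrib_left.2 (h2 h)).and
          (Filter.eventually_imp_distrib_left.2 h3))
    obtain ⟨x, hx1, hx2⟩ := ((show ∀ᶠ x in U, x ∈ leastLetter o from hU).and this).exists
    exact ⟨x, hx1.1, hx2⟩
  choose nx hnx1 hnx2 using next
  classical
  cases nonempty_fintype A
  -- `P n` holds all raised products of the first `n` words. It is finite, so one new word serves
  -- all of them and all raising levels at once.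
  let P : ℕ → Finset (FreeMonoid A) := fun n => Nat.rec {1}
    (fun _ Q => (Q ×ˢ Finset.univ).image fun q : FreeMonoid A × A => q.1 * raise q.2 (nx Q)) n
  have hP : ∀ n, P (n + 1) = (P n ×ˢ Finset.univ).image
      fun q : FreeMonoid A × A => q.1 * raise q.2 (nx (P n)) := fun n => rfl
  have hmem : ∀ u n, raisedProd (fun n => nx (P n)) u n ∈ P n := by
    intro u n
    induction n with
    | zero => simp [P, raisedProd]
    | succ n ih =>
      rw [hP, Finset.mem_image]
      exact ⟨(_, u n), Finset.mem_product.2 ⟨ih, Finset.mem_univ _⟩, rfl⟩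
  have hopen : ∀ u n, Open (raisedProd (fun n => nx (P n)) u n) := by
    intro u n
    induction n with
    | zero => simpa [Open, raisedProd] using hi
    | succ n ih => exact (hnx2 (P n) _ (hmem u n) (u n)).1 ih
  have hclosed : ∀ u n, (∃ k < n, u k = o) → Closed (raisedProd (fun n => nx (P n)) u n) := by
    intro u n
    induction n with
    | zero => rintro ⟨k, hk, _⟩; exact absurd hk (Nat.not_lt_zero _)
    | succ n ih =>
      rintro ⟨k, hk, hko⟩
      rcases Nat.lt_succ_iff_lt_or_eq.1 hk with hk | rfl
      · exact (hnx2 (P n) _ (hmem u n) (u n)).2.2 (ih ⟨k, hk, hko⟩)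
      · exact (hnx2 (P k) _ (hmem u k) (u k)).2.1 (hopen u k) hko
  exact ⟨i, fun n => nx (P n), fun n => hnx1 _, fun u n h => (hclosed u n h).1⟩

end UltrafilterProducts

/-! ### Alignment of letters in two raised concatenations. -/

section RaisedPairs

variable {A : Type*} [LinearOrder A]

/-- Raising preserves length, so zipping two products pairs each letter with another raising of the
same original letter. -/
lemma length_raisedProd (w : ℕ → FreeMonoid A) (u v : ℕ → A) (n : ℕ) :
    (raisedProd w u n).toList.length = (raisedProd w v n).toList.length := by
  induction n with
  | zero => rfl
  | succ n ih => simp [raisedProd, ih, raise]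

lemma mem_zip_raisedProd {w : ℕ → FreeMonoid A} {u v : ℕ → A} {n : ℕ} {p : A × A} :
    p ∈ (raisedProd w u n).toList.zip (raisedProd w v n).toList ↔
      ∃ k < n, ∃ c ∈ (w k).toList, p = (max (u k) c, max (v k) c) := by
  induction n with
  | zero => simp [raisedProd]
  | succ n ih =>
    rw [raisedProd, raisedProd, FreeMonoid.toList_mul, FreeMonoid.toList_mul,
      List.zip_append (length_raisedProd w u v n), List.mem_append, ih]
    have : p ∈ (raise (u n) (w n)).toList.zip (raise (v n) (w n)).toList ↔
        ∃ c ∈ (w n).toList, p = (max (u n) c, max (v n) c) := by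
      simp only [raise, FreeMonoid.toList_map, List.zip_map']
      simp [eq_comm]
    rw [this]
    constructor
    · rintro (⟨k, hk, h⟩ | h)
      · exact ⟨k, hk.trans (Nat.lt_succ_self n), h⟩
      · exact ⟨n, Nat.lt_succ_self n, h⟩
    · rintro ⟨k, hk, h⟩
      rcases Nat.lt_succ_iff_lt_or_eq.1 hk with hk | rfl
      · exact Or.inl ⟨k, hk, h⟩
      · exact Or.inr h

lemma raisedProd_prefix (w : ℕ → FreeMonoid A) (u : ℕ → A) {n k : ℕ} (h : n ≤ k) :
    ∃ r, (raisedProd w u k).toList = (raisedProd w u n).toList ++ r := by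
  induction k, h using Nat.le_induction with
  | base => exact ⟨[], by simp⟩
  | succ k _ ih =>
    obtain ⟨r, hr⟩ := ih
    exact ⟨r ++ (raise (u k) (w k)).toList, by simp [raisedProd, hr]⟩

lemma zip_raisedProd (w : ℕ → FreeMonoid A) (u v : ℕ → A) {n k : ℕ} (h : n ≤ k) :
    (raisedProd w u n).toList.zip (raisedProd w v k).toList =
      (raisedProd w u n).toList.zip (raisedProd w v n).toList := by
  obtain ⟨r, hr⟩ := raisedProd_prefix w v h
  rw [hr]
  conv_lhs => rw [← List.append_nil (raisedProd w u n).toList]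
  rw [List.zip_append (length_raisedProd w u v n)]
  simp

lemma length_raisedProd_lt {w : ℕ → FreeMonoid A} (hw : ∀ n, (w n).toList ≠ []) (u v : ℕ → A)
    {n k : ℕ} (h : n < k) :
    (raisedProd w u n).toList.length < (raisedProd w v k).toList.length := by
  obtain ⟨r, hr⟩ := raisedProd_prefix w v (Nat.succ_le_of_lt h)
  have := List.length_pos_iff.2 (hw n)
  rw [hr, length_raisedProd w u v n]
  simp only [raisedProd, raise, FreeMonoid.toList_mul, FreeMonoid.toList_map, List.length_append,
    List.length_map]
  omega

end RaisedPairs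

/-! ### Extension and amalgamation in Urysohn spaces. -/

section Extension

variable {D : Set ℝ} {M : Type*} [MetricSpace M]

/-- A finite pseudometric space with distances in `D` maps isometrically to `M`. -/
lemma IsUrysohn.exists_isometry_of_pseudo (hM : IsUrysohn D M) (F : Type) [PseudoMetricSpace F]
    [Finite F] (hF : ∀ x y : F, dist x y ∈ D) : ∃ f : F → M, Isometry f := by
  have : Finite (SeparationQuotient F) := Quotient.finite _
  obtain ⟨f, hf⟩ := hM.embeds_finite (SeparationQuotient F) (by
    rintro _ ⟨x, y, rfl⟩
    obtain ⟨x, rfl⟩ := SeparationQuotient.surjective_mk x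
    obtain ⟨y, rfl⟩ := SeparationQuotient.surjective_mk y
    exact hF x y)
  exact ⟨f ∘ SeparationQuotient.mk, hf.comp (Isometry.of_dist_eq fun _ _ => rfl)⟩

lemma IsUrysohn.dist_mem (hM : IsUrysohn D M) (x y : M) : dist x y ∈ D :=
  hM.distSet_eq ▸ ⟨x, y, rfl⟩

lemma IsUrysohn.nonneg (hM : IsUrysohn D M) {r : ℝ} (hr : r ∈ D) : 0 ≤ r := by
  rw [← hM.distSet_eq] at hr
  obtain ⟨x, y, rfl⟩ := hr
  exact dist_nonneg

/-- Katětov functions with values in `D` over finite subspaces are realised. -/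
lemma IsUrysohn.exists_realisation [Nonempty M] (hM : IsUrysohn D M) {n : ℕ} (f : Fin n → M)
    (k : Fin n → ℝ) (hk : ∀ i, k i ∈ D) (h1 : ∀ i j, k i ≤ dist (f i) (f j) + k j)
    (h2 : ∀ i j, dist (f i) (f j) ≤ k i + k j) : ∃ z : M, ∀ i, dist z (f i) = k i := by
  let e : Option (Fin n) → Option (Fin n) → ℝ
    | none, none => 0
    | none, some i => k i
    | some i, none => k i
    | some i, some j => dist (f i) (f j)
  -- Only a pseudometric: `f` may repeat points and `k` may vanish.
  let _ : PseudoMetricSpace (Option (Fin n)) :=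
    { dist := e
      dist_self := by rintro (_ | i) <;> simp [e]
      dist_comm := by rintro (_ | i) (_ | j) <;> simp [e, dist_comm]
      dist_triangle := by
        rintro (_ | i) (_ | j) (_ | l)
        · simp [e]
        · simp [e]
        · simpa [e] using (hM.nonneg (hk j))
        · simpa [e, add_comm, dist_comm] using h1 l j
        · simp [e]
        · simpa [e] using h2 i l
        · simpa [e] using h1 i j
        · simpa [e] using dist_triangle (f i) (f j) (f l) }
  obtain ⟨x₀⟩ := ‹Nonempty M›
  have h0 : (0 : ℝ) ∈ D := dist_self x₀ ▸ hM.dist_mem x₀ x₀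
  obtain ⟨g, hg⟩ := hM.exists_isometry_of_pseudo (Option (Fin n)) (by
    rintro (_ | i) (_ | j)
    · exact h0
    · exact hk j
    · exact hk i
    · exact hM.dist_mem _ _)
  have hgs : ∀ i j : Fin n, dist (g (some i)) (g (some j)) = dist (f i) (f j) := fun i j =>
    hg.dist_eq _ _
  have hgn : ∀ i : Fin n, dist (g none) (g (some i)) = k i := fun i => hg.dist_eq _ _
  let S : Set M := Set.range fun i : Fin n => g (some i)
  have hS : ∀ a : S, ∃ i : Fin n, g (some i) = a := fun a => a.2
  choose c hc using hS
  obtain ⟨φ, hφ⟩ := hM.homogeneous S (Set.finite_range _) (fun a => f (c a))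
    (Isometry.of_dist_eq fun a b => by rw [← hgs, hc, hc]; rfl)
  refine ⟨φ (g none), fun i => ?_⟩
  have : φ (g (some i)) = f i := by
    rw [hφ ⟨g (some i), i, rfl⟩]
    have h := hgs (c ⟨g (some i), i, rfl⟩) i
    rw [hc, dist_self] at h
    exact dist_eq_zero.1 h.symm
  rw [← this, φ.isometry.dist_eq, hgn]

/-- A countable pseudometric space with distances in `D` maps isometrically to `M`. -/
lemma IsUrysohn.exists_map_of_countable [Nonempty M] (hM : IsUrysohn D M) {X : Type*} [Countable X]
    (δ : X → X → ℝ) (hδ : ∀ x y, δ x y ∈ D) (hself : ∀ x, δ x x = 0)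
    (hcomm : ∀ x y, δ x y = δ y x) (htri : ∀ x y z, δ x z ≤ δ x y + δ y z) :
    ∃ Φ : X → M, ∀ x y, dist (Φ x) (Φ y) = δ x y := by
  rcases isEmpty_or_nonempty X with hX | hX
  · exact ⟨isEmptyElim, fun x => isEmptyElim x⟩
  obtain ⟨e, he⟩ := exists_surjective_nat X
  have next : ∀ (n : ℕ) (f : ℕ → M), ∃ z : M,
      (∀ i < n, ∀ j < n, dist (f i) (f j) = δ (e i) (e j)) →
      ∀ i < n, dist z (f i) = δ (e n) (e i) := by
    intro n f
    -- `next` must cover arbitrary `f` for `choose`; if `f` is not distance-preserving below `n`,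
    -- any point will do.
    by_cases hf : ∀ i < n, ∀ j < n, dist (f i) (f j) = δ (e i) (e j)
    · obtain ⟨z, hz⟩ := hM.exists_realisation (fun i : Fin n => f i)
        (fun i => δ (e n) (e i)) (fun i => hδ _ _) (fun i j => by
          rw [hf i i.2 j j.2, hcomm (e i), add_comm]; exact htri _ _ _) (fun i j => by
          rw [hf i i.2 j j.2, hcomm (e n) (e i)]; exact htri _ _ _)
      exact ⟨z, fun _ i hi => hz ⟨i, hi⟩⟩
    · exact ⟨Classical.arbitrary M, fun h => absurd h hf⟩
  choose nx hnx using next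
  let F : ℕ → ℕ → M := fun n => Nat.rec (fun _ => Classical.arbitrary M)
    (fun n f => Function.update f n (nx n f)) n
  have hF : ∀ n, F (n + 1) = Function.update (F n) n (nx n (F n)) := fun n => rfl
  have hdist : ∀ n, ∀ i < n, ∀ j < n, dist (F n i) (F n j) = δ (e i) (e j) := by
    intro n
    induction n with
    | zero => intro i hi; exact absurd hi (Nat.not_lt_zero _)
    | succ n ih =>
      have new := hnx n (F n) ih
      intro i hi j hj
      rw [hF]
      rcases Nat.lt_succ_iff_lt_or_eq.1 hi with hi | rfl <;>
        rcases Nat.lt_succ_iff_lt_or_eq.1 hj with hj | rfl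
      · rw [Function.update_of_ne hi.ne, Function.update_of_ne hj.ne, ih i hi j hj]
      · rw [Function.update_of_ne hi.ne, Function.update_self, dist_comm, new i hi, hcomm]
      · rw [Function.update_of_ne hj.ne, Function.update_self, new j hj]
      · simp [hself]
  have hstable : ∀ i n, i < n → F n i = F (i + 1) i := by
    intro i n hin
    induction n, Nat.succ_le_of_lt hin using Nat.le_induction with
    | base => rfl
    | succ n hn ih => rw [hF, Function.update_of_ne (Nat.lt_of_succ_le hn).ne, ih hn]
  choose s hs using he
  refine ⟨fun x => F (s x + 1) (s x), fun x y => ?_⟩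
  have hx : s x < max (s x) (s y) + 1 := Nat.lt_succ_of_le (le_max_left _ _)
  have hy : s y < max (s x) (s y) + 1 := Nat.lt_succ_of_le (le_max_right _ _)
  change dist (F (s x + 1) (s x)) (F (s y + 1) (s y)) = δ x y
  rw [← hstable _ _ hx, ← hstable _ _ hy, hdist _ _ hx _ hy, hs, hs]

/-- Two triangles with distances in `D` that share a side can be amalgamated. -/
lemma IsUrysohn.exists_amalgam [Nonempty M] (hM : IsUrysohn D M) {a b c e f : ℝ} (ha : a ∈ D)
    (hb : b ∈ D) (hc : c ∈ D) (he : e ∈ D) (hf : f ∈ D) (h1 : f ≤ a + b) (h2 : a ≤ f + b)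
    (h3 : b ≤ f + a) (h4 : e ≤ f + c) (h5 : f ≤ e + c) (h6 : c ≤ f + e) :
    ∃ r ∈ D, r ≤ b + c ∧ e ≤ a + r := by
  have na := hM.nonneg ha
  have nb := hM.nonneg hb
  have nc := hM.nonneg hc
  have ne := hM.nonneg he
  have nf := hM.nonneg hf
  obtain ⟨x⟩ := ‹Nonempty M›
  obtain ⟨z, hz⟩ := hM.exists_realisation ![x] ![f] (by simpa using hf) (by simp)
    (by simpa using nf)
  have hxz : dist x z = f := by simpa [dist_comm] using hz 0
  obtain ⟨y, hy⟩ := hM.exists_realisation ![x, z] ![a, b] (by simp [Fin.forall_fin_two, ha, hb])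
    (by simp [Fin.forall_fin_two, dist_comm z x, hxz, h2, h3])
    (by simp [Fin.forall_fin_two, dist_comm z x, hxz, na, nb]; constructor <;> linarith)
  obtain ⟨w, hw⟩ := hM.exists_realisation ![x, z] ![e, c] (by simp [Fin.forall_fin_two, he, hc])
    (by simp [Fin.forall_fin_two, dist_comm z x, hxz, h4, h6])
    (by simp [Fin.forall_fin_two, dist_comm z x, hxz, nc, ne]; constructor <;> linarith)
  simp only [Fin.forall_fin_two, Matrix.cons_val_zero, Matrix.cons_val_one] at hy hw
  refine ⟨dist y w, hM.dist_mem _ _, ?_, ?_⟩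
  · rw [← hy.2, ← hw.2, dist_comm w z]; exact dist_triangle _ _ _
  · rw [← hy.1, ← hw.1, add_comm, dist_comm y w]; exact dist_triangle _ _ _

end Extension

/-! ### Coding points by words, and the monoid of distances. -/

section Main

variable {M : Type*} [MetricSpace M]

/-- The indivisibility argument, for distances that take values in an abstract finite ordered
monoid `A` with subtraction, read off through `val`. -/
lemma isIndivisible_of_orderedMonoid {A : Type*} [LinearOrder A] [Finite A] [AddCommMonoid A]
    [Sub A] [IsOrderedAddMonoid A] [OrderedSub A] [OrderTop A] (h0 : ∀ a : A, 0 ≤ a) [Countable M]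
    [Nonempty M] (val : A → ℝ) (d : M → M → A) (hd : ∀ x y, val (d x y) = dist x y)
    (hself : ∀ x, d x x = 0) (hcomm : ∀ x y, d x y = d y x)
    (htri : ∀ x y z, d x z ≤ d x y + d y z)
    (hembed : ∀ δ : List A → List A → A, (∀ u, δ u u = 0) → (∀ u v, δ u v = δ v u) →
      (∀ u v w, δ u w ≤ δ u v + δ v w) →
      ∃ Φ : List A → M, ∀ u v, dist (Φ u) (Φ v) = val (δ u v)) :
    IsIndivisible M := by
  intro χ
  obtain ⟨Φ, hΦ⟩ := hembed wordDist wordDist_self wordDist_comm (wordDist_triangle h0)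
  obtain ⟨i, w, hw, hmono⟩ := exists_monochromatic_raisedProd h0
    (fun u : FreeMonoid A => χ (Φ u.toList))
  obtain ⟨pt, hpt⟩ := exists_surjective_nat M
  choose s hs using hpt
  have hsinj : ∀ x y, s x = s y → x = y := fun x y h => by rw [← hs x, h, hs y]
  let code : M → List A := fun x => (raisedProd w (fun j => d x (pt j)) (s x + 1)).toList
  have hcode : ∀ x y, s x < s y → wordDist (code x) (code y) = d x y := by
    intro x y hxy
    have hlt := length_raisedProd_lt (fun n => List.ne_nil_of_mem (hw n))
      (fun j => d x (pt j)) (fun j => d y (pt j)) (Nat.succ_lt_succ hxy)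
    have hzip := zip_raisedProd w (fun j => d x (pt j)) (fun j => d y (pt j))
      (Nat.succ_le_succ hxy.le)
    refine wordDist_eq h0 (fun h => hlt.ne (congrArg List.length h)) ?_ ?_
    · intro p hp
      rw [hzip, mem_zip_raisedProd] at hp
      obtain ⟨k, -, c, -, rfl⟩ := hp
      -- Raising a common letter `c` to both distances preserves the triangle inequalities through
      -- `pt k`.
      have mono : ∀ a b e : A, a ≤ e + b → max a c ≤ e + max b c := fun a b e h =>
        max_le (h.trans (add_le_add le_rfl (le_max_left _ _)))
          ((le_max_right _ _).trans (le_add_of_nonneg_left (h0 _)))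
      refine ⟨gap_le_iff.2 ⟨mono _ _ _ (htri x y _), mono _ _ _ ?_⟩, ?_⟩
      · rw [hcomm x y]; exact htri y x _
      · have := htri x (pt k) y
        rw [hcomm (pt k) y] at this
        exact this.trans (add_le_add (le_max_left _ _) (le_max_left _ _))
    · refine ⟨(d x x, d y x), ?_, by rw [hself, zero_add, hcomm]⟩
      rw [hzip, mem_zip_raisedProd]
      -- The block of index `s x` is the last one in the code of `x`, hence the `s x + 1` in `code`;
      -- its letter `0` records the two distances to `x` itself.
      exact ⟨s x, Nat.lt_succ_self _, 0, hw _, by simp [hs, h0]⟩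
  refine ⟨i, Set.range (Φ ∘ code), ⟨Φ ∘ code, Isometry.of_dist_eq fun x y => ?_, rfl⟩, ?_⟩
  · simp only [Function.comp_apply]
    rcases lt_trichotomy (s x) (s y) with h | h | h
    · rw [hΦ, hcode x y h, hd]
    · rw [hsinj x y h, dist_self, dist_self]
    · rw [dist_comm, hΦ, hcode y x h, hd, dist_comm]
  · rintro _ ⟨x, rfl⟩
    exact hmono _ _ ⟨s x, Nat.lt_succ_self _, by rw [hs, hself]⟩

/-- A countable Urysohn metric space with finitely many distances is indivisible. -/
theorem IsUrysohn.isIndivisible {D : Set ℝ} (hfin : D.Finite) [Countable M] (hM : IsUrysohn D M) :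
    IsIndivisible M := by
  rcases isEmpty_or_nonempty M with hE | hne
  · exact fun χ => ⟨0, ∅, ⟨id, isometry_id, by simpa using hE⟩, by simp⟩
  have hfinite : Finite D := hfin
  obtain ⟨x₀⟩ := id hne
  let o : D := ⟨0, dist_self x₀ ▸ hM.dist_mem x₀ x₀⟩
  have hnn : ∀ a : D, (0 : ℝ) ≤ a := fun a => hM.nonneg a.2
  have hplus : ∀ a b : D, ∃ s : D, ∀ c : D, c ≤ s ↔ (c : ℝ) ≤ a + b := by
    intro a b
    obtain ⟨s, hs, hmax⟩ := Set.exists_max_image {c : D | (c : ℝ) ≤ a + b} id (Set.toFinite _)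
      ⟨a, le_add_of_nonneg_right (hnn b)⟩
    exact ⟨s, fun c => ⟨fun h => (show (c : ℝ) ≤ s from h).trans hs, fun h => hmax c h⟩⟩
  choose plus hplus using hplus
  have plus_comm : ∀ a b, plus a b = plus b a := fun a b =>
    eq_of_forall_le_iff fun c => by rw [hplus, hplus, add_comm]
  have plus_mono : ∀ a b c, a ≤ b → plus c a ≤ plus c b := by
    intro a b c hab
    rw [hplus]
    exact ((hplus _ _ _).1 le_rfl).trans (add_le_add le_rfl hab)
  have zero_plus : ∀ a, plus o a = a := fun a =>
    eq_of_forall_le_iff fun c => by rw [hplus]; simp [o]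
  have le_plus : ∀ a b, a ≤ plus a b := fun a b => by
    rw [hplus]; exact le_add_of_nonneg_right (hnn b)
  have plus_assoc_le : ∀ a b c, plus (plus a b) c ≤ plus a (plus b c) := by
    intro a b c
    have f1 : ((plus a b : D) : ℝ) ≤ a + b := (hplus _ _ _).1 le_rfl
    have f2 : (a : ℝ) ≤ plus a b := le_plus a b
    have f3 : (b : ℝ) ≤ plus a b := by rw [plus_comm]; exact le_plus b a
    have e1 : ((plus (plus a b) c : D) : ℝ) ≤ plus a b + c := (hplus _ _ _).1 le_rfl
    have e2 : ((plus a b : D) : ℝ) ≤ plus (plus a b) c := le_plus _ c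
    have e3 : (c : ℝ) ≤ plus (plus a b) c := by rw [plus_comm _ c]; exact le_plus c _
    have na := hnn a
    have nb := hnn b
    have nc := hnn c
    have nf := hnn (plus a b)
    -- Glue the triangles with sides `a, b, a ⊕ b` and `a ⊕ b, c, (a ⊕ b) ⊕ c`. The new diagonal `r`
    -- satisfies `r ≤ b ⊕ c`, so `(a ⊕ b) ⊕ c ≤ a + r` gives the claim.
    obtain ⟨r, hr, h1, h2⟩ := hM.exists_amalgam a.2 b.2 c.2 (plus (plus a b) c).2 (plus a b).2
      f1 (by linarith) (by linarith) e1 (by linarith) (by linarith)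
    rw [hplus a]
    exact h2.trans (add_le_add le_rfl ((hplus b c ⟨r, hr⟩).2 h1))
  have hminus : ∀ a b : D, ∃ s : D, ∀ c : D, s ≤ c ↔ a ≤ plus c b := by
    intro a b
    obtain ⟨s, hs, hmin⟩ := Set.exists_min_image {c : D | a ≤ plus c b} id (Set.toFinite _)
      ⟨a, le_plus a b⟩
    refine ⟨s, fun c => ⟨fun h => ?_, fun h => hmin c h⟩⟩
    have := plus_mono s c b h
    rw [plus_comm b, plus_comm b] at this
    exact (show a ≤ plus s b from hs).trans this
  choose minus hminus using hminus
  obtain ⟨m, -, hm⟩ := Set.exists_max_image (Set.univ : Set D) id (Set.toFinite _) ⟨o, trivial⟩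
  let _ : AddCommMonoid D :=
    { add := plus
      zero := o
      add_assoc := fun a b c => le_antisymm (plus_assoc_le a b c) (by
        have := plus_assoc_le c b a
        rwa [plus_comm _ a, plus_comm c b, plus_comm c, plus_comm b a] at this)
      zero_add := zero_plus
      add_zero := fun a => (plus_comm a o).trans (zero_plus a)
      add_comm := plus_comm
      nsmul := @nsmulRec D ⟨o⟩ ⟨plus⟩ }
  let _ : Sub D := ⟨minus⟩
  have : IsOrderedAddMonoid D := ⟨fun a b h c => by
    have := plus_mono a b c h
    rw [plus_comm c, plus_comm c] at this
    exact this, fun a b h c => plus_mono a b c h⟩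
  have : OrderedSub D := ⟨fun a b c => hminus a b c⟩
  let _ : OrderTop D := { top := m, le_top := fun a => hm a trivial }
  refine isIndivisible_of_orderedMonoid (A := D) (fun a => hnn a) (fun a => (a : ℝ))
    (fun x y => ⟨dist x y, hM.dist_mem x y⟩) (fun x y => rfl)
    (fun x => Subtype.ext (dist_self x)) (fun x y => Subtype.ext (dist_comm x y))
    (fun x y z => (hplus _ _ _).2 (dist_triangle x y z)) ?_
  intro δ h1 h2 h3
  refine hM.exists_map_of_countable (fun u v => (δ u v : ℝ)) (fun u v => (δ u v).2)
    (fun u => congrArg Subtype.val (h1 u)) (fun u v => congrArg Subtype.val (h2 u v))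
    (fun u v w => (hplus _ _ _).1 (h3 u v w))

end Main

end UrysohnFinite

theorem theorem9p1 (D : Set ℝ) (hfin : D.Finite) (hD : UrysohnFinite.IsUniversal D)
    (M : Type*) [MetricSpace M] [Countable M] (hM : UrysohnFinite.IsUrysohn D M) :
    UrysohnFinite.IsIndivisible M :=
  hM.isIndivisible hfin
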